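/- Let $K\subset\mathbb{R}^2$ be a nonempty, compact, convex set of constant width $w$, i.e. in every direction the distance between the two parallel supporting lines of $K$ is $w$. Let $u(\theta)=(\cos\theta,\sin\theta)$, let $h(\theta)=\max_{x\in K}x\cdot u(\theta)$, $\theta\in\mathbb{R}$, be the support function of $K$, and let $A(K)$ be the area (Lebesgue measure) of $K$. Then $h$ is continuously differentiable on $\mathbb{R}$, its second derivative $h''(\theta)$ exists for almost every $\theta$, the functions $h(h''+h)$ and $h^2-(h')^2$ are integrable on $[0,2\pi]$, and $$A(K)=\frac12\int_0^{2\pi}h(\theta)\bigl(h''(\theta)+h(\theta)\bigr)\,d\theta=\frac12\int_0^{2\pi}\bigl(h(\theta)^2-h'(\theta)^2\bigr)\,d\theta .$$ -/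

import Mathlib

open MeasureTheory

noncomputable section

namespace ConstantWidth

/-- The Euclidean plane. -/
abbrev Plane : Type := EuclideanSpace ℝ (Fin 2)

/-- The unit vector `u(θ) = (cos θ, sin θ)`. -/
def direction (θ : ℝ) : Plane := !₂[Real.cos θ, Real.sin θ]

/-- The support function `h(θ) = max {x · u(θ) : x ∈ K}`; for nonempty compact `K` the supremum
is attained, see `isGreatest_supportFunction`. -/
def supportFunction (K : Set Plane) (θ : ℝ) : ℝ :=
  sSup ((fun x : Plane => inner ℝ x (direction θ)) '' K)

/-- The supporting line of `K` with outward normal `u(θ)`. -/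
def supportLine (K : Set Plane) (θ : ℝ) : Set Plane :=
  {x | inner ℝ x (direction θ) = supportFunction K θ}

/-- The distance between two (nonempty) subsets of the plane: the infimum of the distances between
a point of one and a point of the other. -/
def setDist (A B : Set Plane) : ℝ := sInf (Set.image2 dist A B)

/-- `K` is a shape of constant width `w`: a nonempty, convex and compact set such that in every
direction the two parallel supporting lines, with outward normals `u(θ)` and
`u(θ + π) = -u(θ)`, are at distance `w` from each other. -/
structure IsConstantWidth (K : Set Plane) (w : ℝ) : Prop where
  convex : Convex ℝ K
  isCompact : IsCompact K
  nonempty : K.Nonempty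
  width_eq : ∀ θ : ℝ, setDist (supportLine K θ) (supportLine K (θ + Real.pi)) = w

theorem isGreatest_supportFunction {K : Set Plane} (hK : IsCompact K) (hne : K.Nonempty) (θ : ℝ) :
    IsGreatest ((fun x : Plane => inner ℝ x (direction θ)) '' K) (supportFunction K θ) :=
  (hK.image (by fun_prop)).isGreatest_sSup (hne.image _)

end ConstantWidth

end

noncomputable section

namespace ConstantWidth

/-! Constant width forces the diameter of K to be at most w. Hence a contact point p in direction
u(θ) has opposite contact point exactly p - w u(θ), and K lies in the disk of radius w about that
point (`sq_dist_supportPoint_le`). Comparing two such disks shows that the contact point γ(θ) = (X,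
Y) is w-Lipschitz in θ (`sq_add_sq_le`). All the regularity comes from this: h = γ·u and h' = γ·u',
so h' is Lipschitz on bounded intervals and h'' exists almost everywhere.

For the area, γ runs along the top of K on [0, π] and along the bottom on [π, 2π], with X monotone
on each arc. Slicing vertically and substituting a = X(θ) gives -∫ X'Y, which periodicity turns into
½∫ (XY' - X'Y). Since γ' is orthogonal to u, the integrand is h(h'' + h) almost everywhere.
Integrating h h'' by parts gives the second form. -/

theorem inner_direction (p : Plane) (θ : ℝ) :
    inner ℝ p (direction θ) = p 0 * Real.cos θ + p 1 * Real.sin θ := by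
  simp [direction, PiLp.inner_apply, Fin.sum_univ_two, mul_comm]

theorem dist_sq_plane (p q : Plane) : dist p q ^ 2 = (p 0 - q 0) ^ 2 + (p 1 - q 1) ^ 2 := by
  rw [EuclideanSpace.dist_eq, Real.sq_sqrt (by positivity), Fin.sum_univ_two, Real.dist_eq,
    Real.dist_eq, sq_abs, sq_abs]

theorem sq_mul_cos_add_mul_sin_le (a b θ : ℝ) :
    (a * Real.cos θ + b * Real.sin θ) ^ 2 ≤ a ^ 2 + b ^ 2 := by
  nlinarith [sq_nonneg (a * Real.sin θ - b * Real.cos θ), Real.sin_sq_add_cos_sq θ]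

/-! ### Support function and the distance between supporting lines -/

theorem supportFunction_le {K : Set Plane} (hK : IsCompact K) {p : Plane} (hp : p ∈ K) (θ : ℝ) :
    p 0 * Real.cos θ + p 1 * Real.sin θ ≤ supportFunction K θ := by
  rw [← inner_direction]
  exact (isGreatest_supportFunction hK ⟨p, hp⟩ θ).2 ⟨p, hp, rfl⟩

theorem exists_mem_supportFunction {K : Set Plane} (hK : IsCompact K) (hne : K.Nonempty) (θ : ℝ) :
    ∃ p ∈ K, p 0 * Real.cos θ + p 1 * Real.sin θ = supportFunction K θ := by
  obtain ⟨p, hp, h⟩ := (isGreatest_supportFunction hK hne θ).1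
  exact ⟨p, hp, by rw [← inner_direction]; exact h⟩

theorem supportFunction_add_two_pi (K : Set Plane) (θ : ℝ) :
    supportFunction K (θ + 2 * Real.pi) = supportFunction K θ := by
  simp [supportFunction, direction]

theorem supportFunction_add_nonneg {K : Set Plane} (hK : IsCompact K) (hne : K.Nonempty) (θ : ℝ) :
    0 ≤ supportFunction K θ + supportFunction K (θ + Real.pi) := by
  obtain ⟨p, hp⟩ := hne
  have h1 := supportFunction_le hK hp θ
  have h2 := supportFunction_le hK hp (θ + Real.pi)
  rw [Real.cos_add_pi, Real.sin_add_pi] at h2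
  linarith

theorem setDist_supportLine {K : Set Plane} (hK : IsCompact K) (hne : K.Nonempty) (θ : ℝ) :
    setDist (supportLine K θ) (supportLine K (θ + Real.pi)) =
      supportFunction K θ + supportFunction K (θ + Real.pi) := by
  have h0 := supportFunction_add_nonneg hK hne θ
  set a := supportFunction K θ with ha
  set b := supportFunction K (θ + Real.pi) with hb
  have hcs := Real.sin_sq_add_cos_sq θ
  refine IsLeast.csInf_eq ⟨?_, ?_⟩
  -- The feet of the perpendiculars from the origin to the two lines; they need not lie in K.
  · refine ⟨!₂[a * Real.cos θ, a * Real.sin θ], ?_, !₂[-b * Real.cos θ, -b * Real.sin θ], ?_, ?_⟩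
    · simp only [supportLine, Set.mem_ofPred_eq, inner_direction]
      simp
      linear_combination a * hcs
    · simp only [supportLine, Set.mem_ofPred_eq, inner_direction, Real.cos_add_pi, Real.sin_add_pi]
      simp
      linear_combination b * hcs
    · rw [← sq_eq_sq₀ dist_nonneg h0, dist_sq_plane]
      simp
      linear_combination (a + b) ^ 2 * hcs
  · rintro _ ⟨p, hp, q, hq, rfl⟩
    simp only [supportLine, Set.mem_ofPred_eq, inner_direction, Real.cos_add_pi,
      Real.sin_add_pi] at hp hq
    refine abs_le_of_sq_le_sq' ?_ dist_nonneg |>.2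
    rw [dist_sq_plane]
    have := sq_mul_cos_add_mul_sin_le (p 0 - q 0) (p 1 - q 1) θ
    have e : a + b = (p 0 - q 0) * Real.cos θ + (p 1 - q 1) * Real.sin θ := by
      rw [ha, hb]; linarith
    rwa [e]

/-! ### Diameter and enclosing disks -/

namespace IsConstantWidth

variable {K : Set Plane} {w : ℝ}

theorem supportFunction_add (hK : IsConstantWidth K w) (θ : ℝ) :
    supportFunction K θ + supportFunction K (θ + Real.pi) = w := by
  rw [← setDist_supportLine hK.isCompact hK.nonempty, hK.width_eq]

theorem width_nonneg (hK : IsConstantWidth K w) : 0 ≤ w := by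
  rw [← hK.supportFunction_add 0]
  exact supportFunction_add_nonneg hK.isCompact hK.nonempty 0

/-- In the direction of p - q, the segment from q to p fits between two supporting lines at distance
w. -/
theorem sq_dist_le (hK : IsConstantWidth K w) {p q : Plane} (hp : p ∈ K) (hq : q ∈ K) :
    (p 0 - q 0) ^ 2 + (p 1 - q 1) ^ 2 ≤ w ^ 2 := by
  set z : ℂ := ⟨p 0 - q 0, p 1 - q 1⟩ with hz
  have hre : ‖z‖ * Real.cos z.arg = p 0 - q 0 := Complex.norm_mul_cos_arg z
  have him : ‖z‖ * Real.sin z.arg = p 1 - q 1 := Complex.norm_mul_sin_arg z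
  have h1 := supportFunction_le hK.isCompact hp z.arg
  have h2 := supportFunction_le hK.isCompact hq (z.arg + Real.pi)
  have h3 := hK.supportFunction_add z.arg
  rw [Real.cos_add_pi, Real.sin_add_pi] at h2
  have hcs := Real.sin_sq_add_cos_sq z.arg
  have h4 : ‖z‖ ≤ w := by
    have : ‖z‖ = (p 0 - q 0) * Real.cos z.arg + (p 1 - q 1) * Real.sin z.arg := by
      rw [← hre, ← him]; linear_combination -‖z‖ * hcs
    rw [this]; linarith
  have h5 : (p 0 - q 0) ^ 2 + (p 1 - q 1) ^ 2 = ‖z‖ ^ 2 := by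
    rw [← hre, ← him]; linear_combination ‖z‖ ^ 2 * hcs
  rw [h5]
  exact pow_le_pow_left₀ (norm_nonneg z) h4 2

/-- A set of constant width `w` lies in the disk of radius `w` that touches its supporting line at a
given point of contact. -/
theorem sq_dist_supportPoint_le (hK : IsConstantWidth K w) {θ : ℝ} {p q : Plane} (hp : p ∈ K)
    (hpθ : p 0 * Real.cos θ + p 1 * Real.sin θ = supportFunction K θ) (hq : q ∈ K) :
    (q 0 - p 0) ^ 2 + (q 1 - p 1) ^ 2 ≤
      2 * w * (supportFunction K θ - (q 0 * Real.cos θ + q 1 * Real.sin θ)) := by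
  obtain ⟨y, hy, hyθ⟩ := exists_mem_supportFunction hK.isCompact hK.nonempty (θ + Real.pi)
  rw [Real.cos_add_pi, Real.sin_add_pi] at hyθ
  have hw := hK.supportFunction_add θ
  have hcs := Real.sin_sq_add_cos_sq θ
  have h1 := hK.sq_dist_le hp hy
  have hu : (p 0 - y 0) * Real.cos θ + (p 1 - y 1) * Real.sin θ = w := by linarith
  -- p - y has length at most w and component w along u(θ), so it equals w u(θ).
  have h2 : (p 0 - y 0 - w * Real.cos θ) ^ 2 + (p 1 - y 1 - w * Real.sin θ) ^ 2 ≤ 0 := by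
    have : (p 0 - y 0 - w * Real.cos θ) ^ 2 + (p 1 - y 1 - w * Real.sin θ) ^ 2 =
        (p 0 - y 0) ^ 2 + (p 1 - y 1) ^ 2 - w ^ 2 := by
      linear_combination w ^ 2 * hcs - 2 * w * hu
    linarith
  have h3 : y 0 = p 0 - w * Real.cos θ := by
    nlinarith [sq_nonneg (p 0 - y 0 - w * Real.cos θ), sq_nonneg (p 1 - y 1 - w * Real.sin θ)]
  have h4 : y 1 = p 1 - w * Real.sin θ := by
    nlinarith [sq_nonneg (p 0 - y 0 - w * Real.cos θ), sq_nonneg (p 1 - y 1 - w * Real.sin θ)]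
  have h5 := hK.sq_dist_le hq hy
  rw [h3, h4] at h5
  rw [← hpθ]
  linear_combination h5 - w ^ 2 * hcs

end IsConstantWidth

/-- `(X θ, Y θ)` is the point of contact of `K` with its supporting line in direction `θ`, and the
disk of radius `w` touching that line at this point contains `K`. -/
structure IsContactCurve (K : Set Plane) (w : ℝ) (X Y : ℝ → ℝ) : Prop where
  nonneg : 0 ≤ w
  mem : ∀ θ, !₂[X θ, Y θ] ∈ K
  support : ∀ θ, X θ * Real.cos θ + Y θ * Real.sin θ = supportFunction K θ
  le : ∀ θ, ∀ p ∈ K, p 0 * Real.cos θ + p 1 * Real.sin θ ≤ supportFunction K θ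
  sq_dist_le : ∀ θ, ∀ p ∈ K, (p 0 - X θ) ^ 2 + (p 1 - Y θ) ^ 2 ≤
    2 * w * (supportFunction K θ - (p 0 * Real.cos θ + p 1 * Real.sin θ))

theorem IsConstantWidth.exists_isContactCurve {K : Set Plane} {w : ℝ} (hK : IsConstantWidth K w) :
    ∃ X Y : ℝ → ℝ, IsContactCurve K w X Y := by
  choose x hx hxθ using exists_mem_supportFunction hK.isCompact hK.nonempty
  refine ⟨fun θ => x θ 0, fun θ => x θ 1, hK.width_nonneg, fun θ => ?_, hxθ,
    fun θ p hp => supportFunction_le hK.isCompact hp θ,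
    fun θ p hp => hK.sq_dist_supportPoint_le (hx θ) (hxθ θ) hp⟩
  convert hx θ using 1
  ext i
  fin_cases i <;> rfl

theorem sin_nonpos_of_mem_Icc_pi_two_pi {θ : ℝ} (hθ : θ ∈ Set.Icc Real.pi (2 * Real.pi)) :
    Real.sin θ ≤ 0 := by
  rw [← Real.sin_sub_two_pi]
  exact Real.sin_nonpos_of_nonpos_of_neg_pi_le (by linarith [hθ.2]) (by linarith [hθ.1])

/-- Squared length of a chord of the unit circle. -/
theorem sq_cos_sub_add_sq_sin_sub_le (θ φ : ℝ) :
    (Real.cos φ - Real.cos θ) ^ 2 + (Real.sin φ - Real.sin θ) ^ 2 ≤ (φ - θ) ^ 2 := by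
  have e : (Real.cos φ - Real.cos θ) ^ 2 + (Real.sin φ - Real.sin θ) ^ 2 =
      2 - 2 * Real.cos (φ - θ) := by
    rw [Real.cos_sub]
    linear_combination Real.sin_sq_add_cos_sq θ + Real.sin_sq_add_cos_sq φ
  have := Real.one_sub_sq_div_two_le_cos (x := φ - θ)
  linarith

/-- Cramer's rule: eliminating the increment of Y lets the support inequalities at θ and φ decide
the sign of the increment of X. -/
theorem sin_sub_mul_fst_sub (X Y : ℝ → ℝ) (θ φ : ℝ) :
    -Real.sin (φ - θ) * (X φ - X θ) =
      Real.sin θ * ((X φ - X θ) * Real.cos φ + (Y φ - Y θ) * Real.sin φ) -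
        Real.sin φ * ((X φ - X θ) * Real.cos θ + (Y φ - Y θ) * Real.sin θ) := by
  rw [Real.sin_sub]; ring

/-! ### Regularity and monotonicity of the contact curve -/

namespace IsContactCurve

variable {K : Set Plane} {w : ℝ} {X Y : ℝ → ℝ}

theorem le_curve (hc : IsContactCurve K w X Y) (θ φ : ℝ) :
    X φ * Real.cos θ + Y φ * Real.sin θ ≤ X θ * Real.cos θ + Y θ * Real.sin θ := by
  rw [hc.support θ]
  simpa using hc.le θ _ (hc.mem φ)

/-- With Δ = γ(φ) - γ(θ), adding the disk inequalities at θ and φ gives |Δ|² ≤ w Δ·(u(φ) - u(θ)). -/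
theorem sq_add_sq_le (hc : IsContactCurve K w X Y) (θ φ : ℝ) :
    (X φ - X θ) ^ 2 + (Y φ - Y θ) ^ 2 ≤ w ^ 2 * (φ - θ) ^ 2 := by
  have h1 := hc.sq_dist_le θ _ (hc.mem φ)
  have h2 := hc.sq_dist_le φ _ (hc.mem θ)
  rw [← hc.support] at h1 h2
  simp only [Matrix.cons_val_zero, Matrix.cons_val_one] at h1 h2
  set a := X φ - X θ
  set b := Y φ - Y θ
  set c := Real.cos φ - Real.cos θ
  set s := Real.sin φ - Real.sin θ
  have h3 : a ^ 2 + b ^ 2 ≤ w * (a * c + b * s) := by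
    simp only [a, b, c, s] at *
    linarith
  have h4 : c ^ 2 + s ^ 2 ≤ (φ - θ) ^ 2 := sq_cos_sub_add_sq_sin_sub_le θ φ
  have h5 : a ^ 2 + b ^ 2 ≤ w ^ 2 * (c ^ 2 + s ^ 2) := by
    nlinarith [sq_nonneg (a - w * c), sq_nonneg (b - w * s)]
  exact h5.trans (mul_le_mul_of_nonneg_left h4 (sq_nonneg w))

theorem lipschitzWith_fst (hc : IsContactCurve K w X Y) : LipschitzWith w.toNNReal X := by
  refine LipschitzWith.of_dist_le_mul fun φ θ => ?_
  rw [Real.coe_toNNReal _ hc.nonneg, Real.dist_eq, Real.dist_eq]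
  refine abs_le_of_sq_le_sq ?_ (mul_nonneg hc.nonneg (abs_nonneg _))
  rw [mul_pow, sq_abs]
  nlinarith [hc.sq_add_sq_le θ φ, sq_nonneg (Y φ - Y θ)]

theorem lipschitzWith_snd (hc : IsContactCurve K w X Y) : LipschitzWith w.toNNReal Y := by
  refine LipschitzWith.of_dist_le_mul fun φ θ => ?_
  rw [Real.coe_toNNReal _ hc.nonneg, Real.dist_eq, Real.dist_eq]
  refine abs_le_of_sq_le_sq ?_ (mul_nonneg hc.nonneg (abs_nonneg _))
  rw [mul_pow, sq_abs]
  nlinarith [hc.sq_add_sq_le θ φ, sq_nonneg (X φ - X θ)]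

/-- The contact points are arbitrary choices, but the disk meets its tangent line only once, so they
are unique. -/
theorem add_two_pi (hc : IsContactCurve K w X Y) (θ : ℝ) :
    X (θ + 2 * Real.pi) = X θ ∧ Y (θ + 2 * Real.pi) = Y θ := by
  have h1 := hc.sq_dist_le θ _ (hc.mem (θ + 2 * Real.pi))
  have h2 := hc.support (θ + 2 * Real.pi)
  rw [supportFunction_add_two_pi, Real.cos_add_two_pi, Real.sin_add_two_pi] at h2
  simp only [Matrix.cons_val_zero, Matrix.cons_val_one, h2, sub_self,
    mul_zero] at h1
  constructor <;> nlinarith [sq_nonneg (X (θ + 2 * Real.pi) - X θ),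
    sq_nonneg (Y (θ + 2 * Real.pi) - Y θ)]

/-- The error h(φ) - γ(θ)·u(φ) lies between 0 and (γ(φ) - γ(θ))·(u(φ) - u(θ)), which is O((φ - θ)²).
-/
theorem hasDerivAt_supportFunction (hc : IsContactCurve K w X Y) (θ : ℝ) :
    HasDerivAt (supportFunction K) (-X θ * Real.sin θ + Y θ * Real.cos θ) θ := by
  have hR : HasDerivAt
      (fun φ => supportFunction K φ - (X θ * Real.cos φ + Y θ * Real.sin φ)) 0 θ := by
    have hO : (fun φ => supportFunction K φ - (X θ * Real.cos φ + Y θ * Real.sin φ))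
        =O[nhds θ] fun φ => ‖φ - θ‖ ^ 2 := by
      refine Asymptotics.IsBigO.of_bound (2 * w) (Filter.Eventually.of_forall fun φ => ?_)
      have h1 := hc.le_curve θ φ
      have h2 := hc.le_curve φ θ
      have h3 := hc.sq_add_sq_le θ φ
      rw [← hc.support φ, Real.norm_eq_abs, abs_of_nonneg (by linarith), Real.norm_eq_abs,
        Real.norm_eq_abs, abs_of_nonneg (by positivity), sq_abs]
      set a := X φ - X θ with ha
      set b := Y φ - Y θ with hb
      set c := Real.cos φ - Real.cos θ with hcc
      set s := Real.sin φ - Real.sin θ with hss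
      have h4 : c ^ 2 + s ^ 2 ≤ (φ - θ) ^ 2 := sq_cos_sub_add_sq_sin_sub_le θ φ
      have h5 : a * c + b * s ≤ 2 * w * (φ - θ) ^ 2 := by
        have h6 : (a * c + b * s) ^ 2 ≤ (w * (φ - θ) ^ 2) ^ 2 := by
          calc (a * c + b * s) ^ 2 ≤ (a ^ 2 + b ^ 2) * (c ^ 2 + s ^ 2) := by
                nlinarith [sq_nonneg (a * s - b * c)]
            _ ≤ (w ^ 2 * (φ - θ) ^ 2) * (φ - θ) ^ 2 := by gcongr
            _ = _ := by ring
        have h7 := abs_le_of_sq_le_sq' h6 (mul_nonneg hc.nonneg (sq_nonneg _))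
        nlinarith [mul_nonneg hc.nonneg (sq_nonneg (φ - θ)), h7.2]
      simp only [ha, hb, hcc, hss] at h5
      linarith
    simpa using (hO.hasFDerivAt one_lt_two).hasDerivAt
  have hL : HasDerivAt (fun φ => X θ * Real.cos φ + Y θ * Real.sin φ)
      (X θ * -Real.sin θ + Y θ * Real.cos θ) θ :=
    ((Real.hasDerivAt_cos θ).const_mul _).add ((Real.hasDerivAt_sin θ).const_mul _)
  convert! hR.add hL using 1
  · ext φ; simp
  · ring

theorem antitoneOn_fst (hc : IsContactCurve K w X Y) : AntitoneOn X (Set.Icc 0 Real.pi) := by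
  intro θ hθ φ hφ hle
  have h1 := hc.le_curve θ φ
  have h2 := hc.le_curve φ θ
  have h3 := sin_sub_mul_fst_sub X Y θ φ
  have s1 := Real.sin_nonneg_of_mem_Icc hθ
  have s2 := Real.sin_nonneg_of_mem_Icc hφ
  rcases hle.eq_or_lt with rfl | hlt
  · exact le_rfl
  -- Here sin (φ - θ) = 0 and the identity is void, but θ = 0 and the support inequality there is
  -- the claim.
  by_cases hpi : φ - θ = Real.pi
  · have e1 : θ = 0 := by linarith [hθ.1, hφ.2]
    subst e1
    simp at h1
    exact h1
  have s3 : 0 < Real.sin (φ - θ) :=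
    Real.sin_pos_of_pos_of_lt_pi (by linarith)
      (lt_of_le_of_ne (by linarith [hθ.1, hφ.2]) hpi)
  have h4 : 0 ≤ Real.sin θ * ((X φ - X θ) * Real.cos φ + (Y φ - Y θ) * Real.sin φ) :=
    mul_nonneg s1 (by linarith)
  have h5 : 0 ≤ Real.sin φ * -((X φ - X θ) * Real.cos θ + (Y φ - Y θ) * Real.sin θ) :=
    mul_nonneg s2 (by linarith)
  nlinarith

theorem monotoneOn_fst (hc : IsContactCurve K w X Y) :
    MonotoneOn X (Set.Icc Real.pi (2 * Real.pi)) := by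
  intro θ hθ φ hφ hle
  have h1 := hc.le_curve θ φ
  have h2 := hc.le_curve φ θ
  have h3 := sin_sub_mul_fst_sub X Y θ φ
  have s1 := sin_nonpos_of_mem_Icc_pi_two_pi hθ
  have s2 := sin_nonpos_of_mem_Icc_pi_two_pi hφ
  rcases hle.eq_or_lt with rfl | hlt
  · exact le_rfl
  by_cases hpi : φ - θ = Real.pi
  · have e1 : θ = Real.pi := by linarith [hθ.1, hφ.2]
    subst e1
    simp at h1
    exact h1
  have s3 : 0 < Real.sin (φ - θ) :=
    Real.sin_pos_of_pos_of_lt_pi (by linarith)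
      (lt_of_le_of_ne (by linarith [hθ.1, hφ.2]) hpi)
  have h4 : 0 ≤ -Real.sin θ * ((X φ - X θ) * Real.cos φ + (Y φ - Y θ) * Real.sin φ) :=
    mul_nonneg (by linarith) (by linarith)
  have h5 : 0 ≤ -Real.sin φ * -((X φ - X θ) * Real.cos θ + (Y φ - Y θ) * Real.sin θ) :=
    mul_nonneg (by linarith) (by linarith)
  nlinarith

end IsContactCurve

/-! ### Change of variables for monotone Lipschitz functions -/

theorem _root_.LipschitzWith.volume_image_eq_zero {C : NNReal} {f : ℝ → ℝ} (hf : LipschitzWith C f)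
    {s : Set ℝ} (hs : volume s = 0) : volume (f '' s) = 0 := by
  rw [← hausdorffMeasure_real] at hs ⊢
  have := hf.hausdorffMeasure_image_le zero_le_one s
  rw [hs, mul_zero] at this
  exact le_antisymm this zero_le

theorem _root_.LipschitzWith.image_Icc_ae_eq {C : NNReal} {f : ℝ → ℝ} (hf : LipschitzWith C f)
    {a b : ℝ} (hab : a ≤ b) (hm : MonotoneOn f (Set.Icc a b)) :
    (f '' (Set.Icc a b ∩ {x | DifferentiableAt ℝ f x}) : Set ℝ) =ᵐ[volume]
      Set.Icc (f a) (f b) := by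
  rw [← hf.continuous.continuousOn.image_Icc_of_monotoneOn hab hm]
  refine ae_eq_set.2 ⟨?_, ?_⟩
  · rw [Set.sdiff_eq_empty.2 (Set.image_mono Set.inter_subset_left), measure_empty]
  · refine measure_mono_null ?_ (hf.volume_image_eq_zero (ae_iff.1 hf.ae_differentiableAt_real))
    rintro _ ⟨⟨x, hx, rfl⟩, h⟩
    exact ⟨x, fun hd => h ⟨x, ⟨hx, hd⟩, rfl⟩, rfl⟩

theorem _root_.LipschitzWith.Icc_inter_ae_eq {C : NNReal} {f : ℝ → ℝ} (hf : LipschitzWith C f)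
    (a b : ℝ) : (Set.Icc a b ∩ {x | DifferentiableAt ℝ f x} : Set ℝ) =ᵐ[volume] Set.Ioc a b := by
  refine Filter.EventuallyEq.trans ?_ (Ioc_ae_eq_Icc (μ := volume)).symm
  filter_upwards [hf.ae_differentiableAt_real] with x hx
  apply propext
  change (x ∈ Set.Icc a b ∧ DifferentiableAt ℝ f x) ↔ x ∈ Set.Icc a b
  simp [hx]

/-- Change of variables along a monotone Lipschitz function. -/
theorem _root_.LipschitzWith.integral_Icc_of_monotoneOn {C : NNReal} {f : ℝ → ℝ}
    (hf : LipschitzWith C f) {a b : ℝ} (hab : a ≤ b) (hm : MonotoneOn f (Set.Icc a b))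
    (g : ℝ → ℝ) :
    (IntegrableOn g (Set.Icc (f a) (f b)) ↔
      IntervalIntegrable (fun x => deriv f x * g (f x)) volume a b) ∧
    ∫ y in Set.Icc (f a) (f b), g y = ∫ x in a..b, deriv f x * g (f x) := by
  have hs : MeasurableSet (Set.Icc a b ∩ {x | DifferentiableAt ℝ f x}) :=
    measurableSet_Icc.inter (measurableSet_of_differentiableAt ℝ f)
  have hd : ∀ x ∈ Set.Icc a b ∩ {x | DifferentiableAt ℝ f x},
      HasDerivWithinAt f (deriv f x) (Set.Icc a b ∩ {x | DifferentiableAt ℝ f x}) x :=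
    fun x hx => hx.2.hasDerivAt.hasDerivWithinAt
  have hm' := hm.mono (Set.inter_subset_left (t := {x | DifferentiableAt ℝ f x}))
  constructor
  · rw [← integrableOn_congr_set_ae (hf.image_Icc_ae_eq hab hm),
      integrableOn_image_iff_integrableOn_deriv_smul_of_monotoneOn hs hd hm',
      integrableOn_congr_set_ae (hf.Icc_inter_ae_eq a b),
      intervalIntegrable_iff_integrableOn_Ioc_of_le hab]
    rfl
  · rw [← setIntegral_congr_set (hf.image_Icc_ae_eq hab hm),
      integral_image_eq_integral_deriv_smul_of_monotoneOn hs hd hm',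
      setIntegral_congr_set (hf.Icc_inter_ae_eq a b), intervalIntegral.integral_of_le hab]
    rfl

/-- Change of variables along an antitone Lipschitz function. -/
theorem _root_.LipschitzWith.integral_Icc_of_antitoneOn {C : NNReal} {f : ℝ → ℝ}
    (hf : LipschitzWith C f) {a b : ℝ} (hab : a ≤ b) (hm : AntitoneOn f (Set.Icc a b))
    (g : ℝ → ℝ) :
    (IntegrableOn g (Set.Icc (f b) (f a)) ↔
      IntervalIntegrable (fun x => deriv f x * g (f x)) volume a b) ∧
    ∫ y in Set.Icc (f b) (f a), g y = -∫ x in a..b, deriv f x * g (f x) := by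
  have hf' : LipschitzWith C fun x => f (-x) := by
    simpa [Function.comp_def] using! hf.comp (LipschitzWith.id.neg)
  have hm' : MonotoneOn (fun x => f (-x)) (Set.Icc (-b) (-a)) := fun x hx y hy hxy =>
    hm ⟨by linarith [hy.2], by linarith [hy.1]⟩ ⟨by linarith [hx.2], by linarith [hx.1]⟩
      (by linarith)
  have h := hf'.integral_Icc_of_monotoneOn (neg_le_neg hab) hm' g
  simp only [neg_neg, deriv_comp_neg f, neg_mul] at h
  refine ⟨h.1.trans ?_, h.2.trans ?_⟩
  · rw [IntervalIntegrable.iff_comp_neg (f := fun x => deriv f x * g (f x)) (a := a) (b := b)]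
    exact ⟨fun H => by simpa [Pi.neg_def] using! H.neg.symm, fun H => H.neg.symm⟩
  · rw [intervalIntegral.integral_neg,
      intervalIntegral.integral_comp_neg (fun x => deriv f x * g (f x))]
    simp

/-! ### Area by vertical slices -/

theorem volume_plane_eq_lintegral {K : Set Plane} (hK : IsClosed K) :
    volume K = ∫⁻ a : ℝ, volume {b : ℝ | !₂[a, b] ∈ K} := by
  have h1 := (EuclideanSpace.volume_preserving_symm_measurableEquiv_toLp (Fin 2)).symm
  have h2 := (volume_preserving_finTwoArrow ℝ).symm
  have h3 := h1.comp h2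
  rw [← h3.measure_preimage hK.measurableSet.nullMeasurableSet, Measure.volume_eq_prod,
    Measure.prod_apply (h3.measurable hK.measurableSet)]
  rfl

namespace IsContactCurve

variable {K : Set Plane} {w : ℝ} {X Y : ℝ → ℝ}

/-- If b > Y θ, the disk inequality would give (b - Y θ)² ≤ 2w sin θ (Y θ - b) ≤ 0. This covers θ =
0 and π, where the support inequality says nothing about b. -/
theorem isGreatest_slice (hc : IsContactCurve K w X Y) {θ : ℝ} (hθ : θ ∈ Set.Icc 0 Real.pi) :
    IsGreatest {b : ℝ | !₂[X θ, b] ∈ K} (Y θ) := by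
  refine ⟨hc.mem θ, fun b hb => ?_⟩
  have h1 := hc.sq_dist_le θ _ hb
  rw [← hc.support θ] at h1
  simp only [Matrix.cons_val_zero, Matrix.cons_val_one] at h1
  have s := Real.sin_nonneg_of_mem_Icc hθ
  by_contra! hlt
  have h2 := mul_nonneg (mul_nonneg hc.nonneg s) (sub_nonneg.2 hlt.le)
  nlinarith [pow_pos (sub_pos.2 hlt) 2]

theorem isLeast_slice (hc : IsContactCurve K w X Y) {θ : ℝ}
    (hθ : θ ∈ Set.Icc Real.pi (2 * Real.pi)) :
    IsLeast {b : ℝ | !₂[X θ, b] ∈ K} (Y θ) := by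
  refine ⟨hc.mem θ, fun b hb => ?_⟩
  have h1 := hc.sq_dist_le θ _ hb
  rw [← hc.support θ] at h1
  simp only [Matrix.cons_val_zero, Matrix.cons_val_one] at h1
  have s := sin_nonpos_of_mem_Icc_pi_two_pi hθ
  by_contra! hlt
  have h2 := mul_nonneg (mul_nonneg hc.nonneg (neg_nonneg.2 s)) (sub_nonneg.2 hlt.le)
  nlinarith [pow_pos (sub_pos.2 hlt) 2]

theorem fst_mem_Icc (hc : IsContactCurve K w X Y) {a b : ℝ} (h : !₂[a, b] ∈ K) :
    a ∈ Set.Icc (X Real.pi) (X 0) := by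
  have h0 := hc.le 0 _ h
  have h1 := hc.le Real.pi _ h
  rw [← hc.support] at h0 h1
  simp at h0 h1
  exact ⟨h1, h0⟩

theorem fst_two_pi (hc : IsContactCurve K w X Y) : X (2 * Real.pi) = X 0 := by
  simpa using (hc.add_two_pi 0).1

theorem snd_two_pi (hc : IsContactCurve K w X Y) : Y (2 * Real.pi) = Y 0 := by
  simpa using (hc.add_two_pi 0).2

/-- By the intermediate value theorem both arcs pass over a, so the slice attains its top and
bottom. -/
theorem slice_eq_Icc (hc : IsContactCurve K w X Y) (hK : Convex ℝ K) {a : ℝ}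
    (ha : a ∈ Set.Icc (X Real.pi) (X 0)) :
    sInf {b : ℝ | !₂[a, b] ∈ K} ≤ sSup {b : ℝ | !₂[a, b] ∈ K} ∧
    {b : ℝ | !₂[a, b] ∈ K} =
      Set.Icc (sInf {b : ℝ | !₂[a, b] ∈ K}) (sSup {b : ℝ | !₂[a, b] ∈ K}) := by
  have hX := hc.lipschitzWith_fst.continuous
  obtain ⟨θ, hθ, rfl⟩ := intermediate_value_Icc' Real.pi_pos.le hX.continuousOn ha
  have hpi : Real.pi ≤ 2 * Real.pi := by linarith [Real.pi_pos]
  obtain ⟨φ, hφ, hφθ⟩ := intermediate_value_Icc hpi hX.continuousOn (hc.fst_two_pi.symm ▸ ha)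
  have h1 := hc.isGreatest_slice hθ
  have h2 := hc.isLeast_slice hφ
  rw [hφθ] at h2
  have hconv : Convex ℝ {b : ℝ | !₂[X θ, b] ∈ K} := by
    intro x hx y hy s t hs ht hst
    have := hK hx hy hs ht hst
    change !₂[X θ, s • x + t • y] ∈ K
    convert this using 1
    ext i
    fin_cases i
    · simp [← add_mul, hst]
    · simp
  rw [h1.csSup_eq, h2.csInf_eq]
  refine ⟨h1.2 h2.1, subset_antisymm (fun b hb => ⟨h2.2 hb, h1.2 hb⟩) ?_⟩
  exact hconv.ordConnected.out h2.1 h1.1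

theorem intervalIntegrable_deriv_fst_mul (hc : IsContactCurve K w X Y) (a b : ℝ) :
    IntervalIntegrable (fun θ => deriv X θ * Y θ) volume a b :=
  (hc.lipschitzWith_fst.lipschitzOnWith.absolutelyContinuousOnInterval.intervalIntegrable_deriv
    ).mul_continuousOn hc.lipschitzWith_snd.continuous.continuousOn

theorem intervalIntegrable_mul_deriv_snd (hc : IsContactCurve K w X Y) (a b : ℝ) :
    IntervalIntegrable (fun θ => X θ * deriv Y θ) volume a b :=
  (hc.lipschitzWith_snd.lipschitzOnWith.absolutelyContinuousOnInterval.intervalIntegrable_deriv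
    ).continuousOn_mul hc.lipschitzWith_fst.continuous.continuousOn

/-- Integrability of the upper boundary is pulled back from that of X'Y, so its measurability needs
no separate argument. -/
theorem integral_sSup_slice (hc : IsContactCurve K w X Y) :
    IntegrableOn (fun a => sSup {b : ℝ | !₂[a, b] ∈ K}) (Set.Icc (X Real.pi) (X 0)) ∧
    ∫ a in Set.Icc (X Real.pi) (X 0), sSup {b : ℝ | !₂[a, b] ∈ K} =
      -∫ θ in (0 : ℝ)..Real.pi, deriv X θ * Y θ := by
  have key : Set.EqOn (fun θ => deriv X θ * sSup {b : ℝ | !₂[X θ, b] ∈ K})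
      (fun θ => deriv X θ * Y θ) (Set.uIcc 0 Real.pi) := fun θ hθ => by
    rw [Set.uIcc_of_le Real.pi_pos.le] at hθ
    simp only [(hc.isGreatest_slice hθ).csSup_eq]
  have h := hc.lipschitzWith_fst.integral_Icc_of_antitoneOn Real.pi_pos.le hc.antitoneOn_fst
    fun a => sSup {b : ℝ | !₂[a, b] ∈ K}
  refine ⟨h.1.2 ?_, h.2.trans ?_⟩
  · exact (hc.intervalIntegrable_deriv_fst_mul _ _).congr
      fun θ hθ => (key (Set.uIoc_subset_uIcc hθ)).symm
  · rw [intervalIntegral.integral_congr key]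

theorem integral_sInf_slice (hc : IsContactCurve K w X Y) :
    IntegrableOn (fun a => sInf {b : ℝ | !₂[a, b] ∈ K}) (Set.Icc (X Real.pi) (X 0)) ∧
    ∫ a in Set.Icc (X Real.pi) (X 0), sInf {b : ℝ | !₂[a, b] ∈ K} =
      ∫ θ in Real.pi..(2 * Real.pi), deriv X θ * Y θ := by
  have hpi : Real.pi ≤ 2 * Real.pi := by linarith [Real.pi_pos]
  have key : Set.EqOn (fun θ => deriv X θ * sInf {b : ℝ | !₂[X θ, b] ∈ K})
      (fun θ => deriv X θ * Y θ) (Set.uIcc Real.pi (2 * Real.pi)) := fun θ hθ => by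
    rw [Set.uIcc_of_le hpi] at hθ
    simp only [(hc.isLeast_slice hθ).csInf_eq]
  have h := hc.lipschitzWith_fst.integral_Icc_of_monotoneOn hpi hc.monotoneOn_fst
    fun a => sInf {b : ℝ | !₂[a, b] ∈ K}
  rw [hc.fst_two_pi] at h
  refine ⟨h.1.2 ?_, h.2.trans ?_⟩
  · exact (hc.intervalIntegrable_deriv_fst_mul _ _).congr
      fun θ hθ => (key (Set.uIoc_subset_uIcc hθ)).symm
  · rw [intervalIntegral.integral_congr key]

/-- Green's formula for the area enclosed by the contact curve. -/
theorem volume_real_eq (hc : IsContactCurve K w X Y) (hK : Convex ℝ K) (hcl : IsClosed K) :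
    volume.real K = -∫ θ in (0 : ℝ)..(2 * Real.pi), deriv X θ * Y θ := by
  set I := Set.Icc (X Real.pi) (X 0) with hI
  set g : ℝ → ℝ := fun a => sSup {b : ℝ | !₂[a, b] ∈ K} with hg
  set f : ℝ → ℝ := fun a => sInf {b : ℝ | !₂[a, b] ∈ K} with hf
  obtain ⟨gi, geq⟩ := hc.integral_sSup_slice
  obtain ⟨fi, feq⟩ := hc.integral_sInf_slice
  have hvol : volume K = ∫⁻ a in I, ENNReal.ofReal (g a - f a) := by
    rw [volume_plane_eq_lintegral hcl, ← lintegral_indicator measurableSet_Icc]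
    congr 1 with a
    by_cases ha : a ∈ I
    · rw [Set.indicator_of_mem ha, (hc.slice_eq_Icc hK ha).2, Real.volume_Icc]
    · rw [Set.indicator_of_notMem ha]
      have : {b : ℝ | !₂[a, b] ∈ K} = ∅ :=
        Set.eq_empty_of_forall_notMem fun b hb => ha (hc.fst_mem_Icc hb)
      rw [this, measure_empty]
  have hint : ∫ a in I, (g a - f a) = volume.real K := by
    have hm : AEStronglyMeasurable (fun a => g a - f a) (volume.restrict I) :=
      (gi.sub fi).aestronglyMeasurable
    rw [integral_eq_lintegral_of_nonneg_ae _ hm, ← hvol]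
    · rfl
    · filter_upwards [ae_restrict_mem measurableSet_Icc] with a ha
      exact sub_nonneg.2 (hc.slice_eq_Icc hK ha).1
  rw [← hint, integral_sub gi fi, geq, feq,
    ← intervalIntegral.integral_add_adjacent_intervals
      (hc.intervalIntegrable_deriv_fst_mul 0 Real.pi)
      (hc.intervalIntegrable_deriv_fst_mul Real.pi (2 * Real.pi))]
  ring

/-- By periodicity ∫ (X'Y + XY') = 0; half of it is added to -∫ X'Y. -/
theorem volume_real_eq_half (hc : IsContactCurve K w X Y) (hK : Convex ℝ K) (hcl : IsClosed K) :
    volume.real K =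
      1 / 2 * ∫ θ in (0 : ℝ)..(2 * Real.pi), (X θ * deriv Y θ - deriv X θ * Y θ) := by
  have h1 := hc.volume_real_eq hK hcl
  have h2 := AbsolutelyContinuousOnInterval.integral_deriv_mul_eq_sub (a := 0) (b := 2 * Real.pi)
    hc.lipschitzWith_fst.lipschitzOnWith.absolutelyContinuousOnInterval
    hc.lipschitzWith_snd.lipschitzOnWith.absolutelyContinuousOnInterval
  have i1 := hc.intervalIntegrable_deriv_fst_mul 0 (2 * Real.pi)
  have i2 := hc.intervalIntegrable_mul_deriv_snd 0 (2 * Real.pi)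
  rw [intervalIntegral.integral_add i1 i2, hc.fst_two_pi, hc.snd_two_pi, sub_self] at h2
  rw [intervalIntegral.integral_sub i2 i1]
  linarith

/-! ### Derivatives of h and the two integral formulas -/

theorem deriv_supportFunction (hc : IsContactCurve K w X Y) :
    deriv (supportFunction K) = fun θ => -X θ * Real.sin θ + Y θ * Real.cos θ :=
  funext fun θ => (hc.hasDerivAt_supportFunction θ).deriv

theorem contDiff_supportFunction (hc : IsContactCurve K w X Y) :
    ContDiff ℝ 1 (supportFunction K) := by
  refine contDiff_one_iff_deriv.2
    ⟨fun θ => (hc.hasDerivAt_supportFunction θ).differentiableAt, ?_⟩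
  rw [hc.deriv_supportFunction]
  have := hc.lipschitzWith_fst.continuous
  have := hc.lipschitzWith_snd.continuous
  fun_prop

theorem hasDerivAt_deriv_supportFunction (hc : IsContactCurve K w X Y) {θ : ℝ}
    (hX : DifferentiableAt ℝ X θ) (hY : DifferentiableAt ℝ Y θ) :
    HasDerivAt (deriv (supportFunction K))
      (-deriv X θ * Real.sin θ + deriv Y θ * Real.cos θ - supportFunction K θ) θ := by
  rw [hc.deriv_supportFunction, ← hc.support]
  convert! (hX.hasDerivAt.neg.mul (Real.hasDerivAt_sin θ)).add
    (hY.hasDerivAt.mul (Real.hasDerivAt_cos θ)) using 1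
  simp only [Pi.neg_apply]
  ring

/-- The contact curve moves along its supporting line. -/
theorem deriv_mul_cos_add_deriv_mul_sin (hc : IsContactCurve K w X Y) {θ : ℝ}
    (hX : DifferentiableAt ℝ X θ) (hY : DifferentiableAt ℝ Y θ) :
    deriv X θ * Real.cos θ + deriv Y θ * Real.sin θ = 0 := by
  have h1 := (hX.hasDerivAt.mul (Real.hasDerivAt_cos θ)).add
    (hY.hasDerivAt.mul (Real.hasDerivAt_sin θ))
  have h2 := hc.hasDerivAt_supportFunction θ
  have e : supportFunction K = X * Real.cos + Y * Real.sin := funext fun φ => (hc.support φ).symm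
  rw [e] at h2
  linarith [h1.unique h2]

theorem ae_differentiableAt (hc : IsContactCurve K w X Y) :
    ∀ᵐ θ : ℝ, DifferentiableAt ℝ X θ ∧ DifferentiableAt ℝ Y θ :=
  hc.lipschitzWith_fst.ae_differentiableAt_real.and hc.lipschitzWith_snd.ae_differentiableAt_real

/-- Existence of h'' almost everywhere would not justify integration by parts; absolute continuity
of h' does. -/
theorem absolutelyContinuousOnInterval_deriv_supportFunction (hc : IsContactCurve K w X Y)
    (a b : ℝ) : AbsolutelyContinuousOnInterval (deriv (supportFunction K)) a b := by
  rw [hc.deriv_supportFunction]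
  exact (hc.lipschitzWith_fst.lipschitzOnWith.absolutelyContinuousOnInterval.neg.mul
    Real.contDiff_sin.contDiffOn.absolutelyContinuousOnInterval).add
    (hc.lipschitzWith_snd.lipschitzOnWith.absolutelyContinuousOnInterval.mul
    Real.contDiff_cos.contDiffOn.absolutelyContinuousOnInterval)

/-- Since γ' ⊥ u, γ' = (h'' + h) u', and the cross product of γ with u' is γ·u = h. -/
theorem ae_supportFunction_mul (hc : IsContactCurve K w X Y) :
    ∀ᵐ θ : ℝ, X θ * deriv Y θ - deriv X θ * Y θ = supportFunction K θ *
      (deriv (deriv (supportFunction K)) θ + supportFunction K θ) := by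
  filter_upwards [hc.ae_differentiableAt] with θ ⟨hX, hY⟩
  rw [(hc.hasDerivAt_deriv_supportFunction hX hY).deriv, sub_add_cancel, ← hc.support]
  have h := hc.deriv_mul_cos_add_deriv_mul_sin hX hY
  linear_combination (X θ * Real.sin θ - Y θ * Real.cos θ) * h -
    (X θ * deriv Y θ - deriv X θ * Y θ) * Real.sin_sq_add_cos_sq θ

theorem integral_supportFunction_mul (hc : IsContactCurve K w X Y) :
    ∫ θ in (0 : ℝ)..(2 * Real.pi), supportFunction K θ *
      (deriv (deriv (supportFunction K)) θ + supportFunction K θ) =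
    ∫ θ in (0 : ℝ)..(2 * Real.pi),
      (supportFunction K θ ^ 2 - deriv (supportFunction K) θ ^ 2) := by
  have hd := hc.contDiff_supportFunction
  have hcont := hd.continuous
  have hcont' := hd.continuous_deriv le_rfl
  have hac := hc.absolutelyContinuousOnInterval_deriv_supportFunction 0 (2 * Real.pi)
  have h1 := AbsolutelyContinuousOnInterval.integral_mul_deriv_eq_deriv_mul
    hd.contDiffOn.absolutelyContinuousOnInterval hac
  have e0 : supportFunction K (2 * Real.pi) = supportFunction K 0 := by
    simpa using supportFunction_add_two_pi K 0
  have e1 : deriv (supportFunction K) (2 * Real.pi) = deriv (supportFunction K) 0 := by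
    simp [hc.deriv_supportFunction, hc.snd_two_pi]
  rw [e0, e1, sub_self, zero_sub] at h1
  have hsq : IntervalIntegrable (fun θ => supportFunction K θ ^ 2) volume 0 (2 * Real.pi) :=
    (hcont.pow 2).intervalIntegrable _ _
  have hsq' : IntervalIntegrable (fun θ => deriv (supportFunction K) θ ^ 2) volume 0
      (2 * Real.pi) := (hcont'.pow 2).intervalIntegrable _ _
  have hi := hac.intervalIntegrable_deriv.continuousOn_mul hcont.continuousOn
  simp only [mul_add, ← sq] at h1 ⊢
  rw [intervalIntegral.integral_add hi hsq,
    intervalIntegral.integral_sub hsq hsq', h1]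
  ring

end IsContactCurve

end ConstantWidth

end

theorem mainTheorem6 (K : Set ConstantWidth.Plane) (w : ℝ)
    (hK : ConstantWidth.IsConstantWidth K w)
    (h : ℝ → ℝ) (hh : h = ConstantWidth.supportFunction K) :
    -- `h` is continuously differentiable and twice differentiable almost everywhere
    ContDiff ℝ 1 h ∧ (∀ᵐ θ : ℝ, DifferentiableAt ℝ (deriv h) θ) ∧
    -- the area formula
    IntervalIntegrable (fun θ => h θ * (deriv (deriv h) θ + h θ)) volume 0 (2 * Real.pi) ∧
    volume.real K = 1 / 2 * ∫ θ in (0 : ℝ)..(2 * Real.pi), h θ * (deriv (deriv h) θ + h θ) ∧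
    -- its form after integration by parts
    IntervalIntegrable (fun θ => h θ ^ 2 - deriv h θ ^ 2) volume 0 (2 * Real.pi) ∧
    volume.real K = 1 / 2 * ∫ θ in (0 : ℝ)..(2 * Real.pi), (h θ ^ 2 - deriv h θ ^ 2) := by
  subst hh
  obtain ⟨X, Y, hc⟩ := hK.exists_isContactCurve
  have hd := hc.contDiff_supportFunction
  have hcont := hd.continuous
  have hcont' := hd.continuous_deriv le_rfl
  have harea : volume.real K = 1 / 2 * ∫ θ in (0 : ℝ)..(2 * Real.pi),
      ConstantWidth.supportFunction K θ * (deriv (deriv (ConstantWidth.supportFunction K)) θ +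
        ConstantWidth.supportFunction K θ) := by
    rw [hc.volume_real_eq_half hK.convex hK.isCompact.isClosed]
    congr 1
    refine intervalIntegral.integral_congr_ae ?_
    filter_upwards [hc.ae_supportFunction_mul] with θ hθ _ using hθ
  refine ⟨hd, ?_, ?_, harea, ?_, ?_⟩
  · filter_upwards [hc.ae_differentiableAt] with θ hθ
    exact (hc.hasDerivAt_deriv_supportFunction hθ.1 hθ.2).differentiableAt
  · exact ((hc.absolutelyContinuousOnInterval_deriv_supportFunction _ _).intervalIntegrable_deriv.add
      (hcont.intervalIntegrable _ _)).continuousOn_mul hcont.continuousOn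
  · exact ((hcont.pow 2).sub (hcont'.pow 2)).intervalIntegrable _ _
  · rw [harea, hc.integral_supportFunction_mul]
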